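/- A \emph{Markov chain} has a finite state space $S$, an initial state and a stochastic transition function $S\times S\to[0,1]$; it satisfies the reachability specification $\varphi_r=\mathbb P_{\le\lambda}(\lozenge T)$, with $T\subseteq S$ and $\lambda\in[0,1]$, if the probability that a path started in the initial state ever visits $T$ is at most $\lambda$. A \emph{parametric Markov chain} $\mathcal D$ has instead a transition function $\mathcal P:S\times S\to\mathbb Q[V]$ for a finite set $V$ of real parameters; its parameter space $\mathcal V_{\mathcal D}\subseteq\mathbb R^V$ consists of all $u$ for which the instantiation $\mathcal D[u]$ is a Markov chain, i.e. $\mathcal P(s,s')[u]\in[0,1]$ and $\sum_{s''}\mathcal P(s,s'')[u]=1$ for all $s,s'\in S$. An \emph{uncertain Markov chain} $\mathcal D_{\mathbb P}$ is a parametric Markov chain $\mathcal D$ together with a (Borel) probability distribution $\mathbb P$ on $\mathcal V_{\mathcal D}$, and its satisfaction probability is $$F(\mathcal D_{\mathbb P},\varphi_r)=\int_{\mathcal V_{\mathcal D}} I_{\varphi_r}(u)\,d\mathbb P(u),\qquad I_{\varphi_r}(u)=1\text{ if }\mathcal D[u]\models\varphi_r,\quad I_{\varphi_r}(u)=0\text{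 otherwise.}$$ \textbf{Theorem.} Let $\mathcal D_{\mathbb P}$ be an uncertain Markov chain, $\varphi_r=\mathbb P_{\le\lambda}(\lozenge T)$ a reachability specification, $K\ge 2$, and let $u_1,\dots,u_K$ be independent samples from $\mathbb P$. For $\nu\in[0,1)$ put $$\alpha_\nu=\sum_{i=0}^{1}\binom{K}{i}(1-\nu)^{K-i}\nu^i .$$ Then $I_{\varphi_r}$ is measurable (so that $F(\mathcal D_{\mathbb P},\varphi_r)$ is well defined), and with probability at least $1-\alpha_\nu$ over the samples the following holds: if $\mathcal D[u_k]\models\varphi_r$ for all $k=1,\dots,K$, then $$F(\mathcal D_{\mathbb P},\varphi_r)\ge 1-\nu .$$ -/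

import Mathlib

open MeasureTheory ProbabilityTheory

noncomputable section

/-- A (discrete-time) Markov chain on the state space `S`: an initial state, and for every state
the probability distribution of the successor state. -/
structure MarkovChain (S : Type*) where
  init : S
  trans : S → PMF S

namespace MarkovChain

variable {S : Type*} [Finite S] [MeasurableSpace S] [DiscreteMeasurableSpace S]

/-- The transition function as a Markov kernel on `S`. -/
def transKernel (C : MarkovChain S) : Kernel S S where
  toFun s := (C.trans s).toMeasure
  measurable' := measurable_of_countable _

instance (C : MarkovChain S) : IsMarkovKernel C.transKernel :=
  ⟨fun s => inferInstanceAs (IsProbabilityMeasure (C.trans s).toMeasure)⟩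

/-- The law of the state at time `n + 1` given the states at times `0, …, n`:
it depends only on the state at time `n`. -/
def stepKernel (C : MarkovChain S) (n : ℕ) : Kernel ((i : Finset.Iic n) → S) S :=
  C.transKernel.comap (fun x => x ⟨n, Finset.mem_Iic.2 le_rfl⟩) (measurable_pi_apply _)

instance (C : MarkovChain S) (n : ℕ) : IsMarkovKernel (C.stepKernel n) :=
  inferInstanceAs (IsMarkovKernel (C.transKernel.comap _ _))

/-- The probability measure on infinite paths (with the product `σ`-algebra, i.e. the one generated
by the cylinder sets) of the chain started in its initial state. -/
def pathMeasure (C : MarkovChain S) : Measure (ℕ → S) :=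
  Kernel.trajMeasure (X := fun _ => S) (Measure.dirac C.init) C.stepKernel

/-- The probability `Pr(◇ T)` that a path from the initial state eventually visits `T`. -/
def reachProb (C : MarkovChain S) (T : Set S) : ℝ :=
  C.pathMeasure.real {ω | ∃ n, ω n ∈ T}

end MarkovChain

/-- A reachability specification `P_{≤ bound}(◇ target)`. -/
structure ReachSpec (S : Type*) where
  target : Set S
  bound : ℝ
  bound_mem : bound ∈ Set.Icc (0 : ℝ) 1

/-- `C ⊨ φ`: the target set is reached with probability at most the bound. -/
def MarkovChain.Satisfies {S : Type*} [Finite S] [MeasurableSpace S] [DiscreteMeasurableSpace S]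
    (C : MarkovChain S) (φ : ReachSpec S) : Prop :=
  C.reachProb φ.target ≤ φ.bound

/-- A parametric Markov chain with state space `S` and parameters `V`: the transition function
takes values in the polynomials over `V` with rational coefficients. -/
structure ParametricMC (S V : Type*) where
  init : S
  trans : S → S → MvPolynomial V ℚ

namespace ParametricMC

variable {S V : Type*} [Fintype S]

/-- The parameter space: the well-defined instantiations, those for which substituting the
values for the parameters yields a probability distribution in every state. -/
def paramSpace (D : ParametricMC S V) : Set (V → ℝ) :=
  {v | (∀ s s', MvPolynomial.aeval v (D.trans s s') ∈ Set.Icc (0 : ℝ) 1) ∧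
    ∀ s, ∑ s', MvPolynomial.aeval v (D.trans s s') = (1 : ℝ)}

/-- The instantiated Markov chain `D[u]`. -/
def instantiate (D : ParametricMC S V) (u : D.paramSpace) : MarkovChain S where
  init := D.init
  trans s := PMF.ofFintype
    (fun s' => ENNReal.ofReal (MvPolynomial.aeval (u : V → ℝ) (D.trans s s'))) (by
      rw [← ENNReal.ofReal_sum_of_nonneg fun s' _ => (u.2.1 s s').1, u.2.2 s, ENNReal.ofReal_one])

end ParametricMC

/-- An uncertain Markov chain: a parametric Markov chain together with a probability
distribution over its parameter space. -/
structure UncertainMC (S V : Type*) [Fintype S] where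
  pmc : ParametricMC S V
  dist : Measure pmc.paramSpace
  isProbabilityMeasure_dist : IsProbabilityMeasure dist

namespace UncertainMC

variable {S V : Type*} [Fintype S] [MeasurableSpace S] [DiscreteMeasurableSpace S]

/-- The parameter values whose instantiated chain satisfies `φ`. -/
def satSet (D : UncertainMC S V) (φ : ReachSpec S) : Set D.pmc.paramSpace :=
  {u | (D.pmc.instantiate u).Satisfies φ}

/-- The satisfaction probability `F`: the integral of the indicator of `D[u] ⊨ φ` against the
distribution of the parameters. -/
def satProb (D : UncertainMC S V) (φ : ReachSpec S) : ℝ :=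
  ∫ u, (D.satSet φ).indicator (fun _ => (1 : ℝ)) u ∂D.dist

end UncertainMC

/-- The confidence probability `α_ν` for `K` samples. -/
def confidenceProb (K : ℕ) (ν : ℝ) : ℝ :=
  ∑ i ∈ Finset.range 2, (K.choose i : ℝ) * (1 - ν) ^ (K - i) * ν ^ i

end

/-!
Membership of `u` in `D.satSet φ` is decided by comparing `reachProb` with the bound, so measurability
reduces to measurability of the reachability probability as a function of the parameters. The law of
the first `n + 1` states charges each of the finitely many path prefixes with a product of transition
probabilities (`MarkovChain.map_frestrictLe_pathMeasure_singleton_succ`), which are polynomial in `u`;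
the probability of visiting the target within `n` steps is a finite sum of these, and the
reachability probability is their supremum over `n`
(`ParametricMC.measurable_reachProb_instantiate`).

For the confidence bound, let `F` be the satisfaction probability. If `1 - ν ≤ F`, the event in
question is everything. Otherwise it is the event that some sample violates `φ`, which by
independence has probability `1 - F ^ K ≥ 1 - (1 - ν) ^ K`; and `(1 - ν) ^ K` is the `i = 0` summand of
`confidenceProb K ν`, whose other summand is nonnegative.
-/

open Preorder in
/-- The probability of a path prefix is obtained from that of the prefix without its last state by
multiplying with the probability of the last transition. -/
theorem MarkovChain.map_frestrictLe_pathMeasure_singleton_succ {S : Type*} [Finite S]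
    [MeasurableSpace S] [DiscreteMeasurableSpace S] (C : MarkovChain S) (n : ℕ)
    (x : (i : Finset.Iic (n + 1)) → S) :
    C.pathMeasure.map (frestrictLe (π := fun _ => S) (n + 1)) {x} =
      C.trans (x ⟨n, Finset.mem_Iic.2 n.le_succ⟩) (x ⟨n + 1, Finset.mem_Iic.2 le_rfl⟩) *
      C.pathMeasure.map (frestrictLe (π := fun _ => S) n)
        {frestrictLe₂ (π := fun _ => S) n.le_succ x} := by
  set y : (i : Finset.Iic n) → S := frestrictLe₂ (π := fun _ => S) n.le_succ x with hy
  set s : S := x ⟨n + 1, Finset.mem_Iic.2 le_rfl⟩ with hs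
  have hset : frestrictLe (π := fun _ => S) (n + 1) ⁻¹' {x} =
      (fun ω : ℕ → S => (frestrictLe (π := fun _ => S) n ω, ω (n + 1))) ⁻¹' ({y} ×ˢ {s}) := by
    ext ω
    simp only [Set.mem_preimage, Set.mem_singleton_iff, Set.mem_prod]
    constructor
    · rintro rfl
      exact ⟨rfl, rfl⟩
    · rintro ⟨h1, h2⟩
      ext ⟨i, hi⟩
      rcases Nat.le_succ_iff.1 (Finset.mem_Iic.1 hi) with h | h
      · exact congrFun h1 ⟨i, Finset.mem_Iic.2 h⟩
      · subst h
        exact h2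
  have hprod := Kernel.map_frestrictLe_trajMeasure_compProd_eq_map_trajMeasure
    (X := fun _ => S) (μ₀ := Measure.dirac C.init) (κ := C.stepKernel) (a := n)
  rw [Measure.map_apply (measurable_frestrictLe _) (measurableSet_singleton x), hset,
    ← Measure.map_apply (by fun_prop)
      ((measurableSet_singleton y).prod (measurableSet_singleton s)),
    pathMeasure, ← hprod,
    Measure.compProd_apply_prod (measurableSet_singleton y) (measurableSet_singleton s),
    lintegral_singleton]
  congr 1
  exact PMF.toMeasure_apply_singleton _ _ (measurableSet_singleton s)

open Preorder in
theorem MarkovChain.map_frestrictLe_zero_pathMeasure {S : Type*} [Finite S]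
    [MeasurableSpace S] [DiscreteMeasurableSpace S] (C : MarkovChain S) :
    C.pathMeasure.map (frestrictLe (π := fun _ => S) 0) =
      (Measure.dirac C.init).map
        (MeasurableEquiv.piUnique (fun _ : Finset.Iic 0 => S)).symm := by
  rw [pathMeasure, Kernel.trajMeasure, Measure.map_comp _ _ (by fun_prop),
    Kernel.traj_map_frestrictLe, Kernel.partialTraj_self]
  exact Measure.id_comp

theorem ParametricMC.measurable_instantiate_trans {S V : Type*} [Fintype S] [Finite V]
    (D : ParametricMC S V) (s s' : S) :
    Measurable fun u : D.paramSpace => (D.instantiate u).trans s s' := by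
  have h : Measurable fun v : V → ℝ => MvPolynomial.aeval v (D.trans s s') := by
    simp_rw [MvPolynomial.aeval_eq_eval₂Hom, MvPolynomial.coe_eval₂Hom, MvPolynomial.eval₂_eq]
    fun_prop
  exact (h.comp measurable_subtype_coe).ennreal_ofReal

open Preorder in
theorem ParametricMC.measurable_map_frestrictLe_pathMeasure_singleton {S V : Type*} [Fintype S]
    [MeasurableSpace S] [DiscreteMeasurableSpace S] [Finite V] (D : ParametricMC S V) (n : ℕ)
    (x : (i : Finset.Iic n) → S) :
    Measurable fun u : D.paramSpace =>
      (D.instantiate u).pathMeasure.map (frestrictLe (π := fun _ => S) n) {x} := by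
  induction n with
  | zero =>
    simp_rw [MarkovChain.map_frestrictLe_zero_pathMeasure]
    -- every instantiation has the initial state of `D`
    change Measurable fun _ => ((Measure.dirac D.init).map
      (MeasurableEquiv.piUnique (fun _ : Finset.Iic 0 => S)).symm) {x}
    exact measurable_const
  | succ n ih =>
    simp_rw [MarkovChain.map_frestrictLe_pathMeasure_singleton_succ]
    exact (D.measurable_instantiate_trans _ _).mul (ih _)

open Preorder in
theorem ParametricMC.measurable_reachProb_instantiate {S V : Type*} [Fintype S]
    [MeasurableSpace S] [DiscreteMeasurableSpace S] [Finite V] (D : ParametricMC S V)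
    (T : Set S) :
    Measurable fun u : D.paramSpace => (D.instantiate u).reachProb T := by
  classical
  -- reaching `T` is the increasing union of the events of reaching it within `n` steps
  have hset : {ω : ℕ → S | ∃ n, ω n ∈ T} =
      ⋃ n, frestrictLe (π := fun _ => S) n ⁻¹' {x | ∃ i, x i ∈ T} := by
    ext ω
    simp only [Set.mem_ofPred_eq, Set.mem_iUnion, Set.mem_preimage]
    exact ⟨fun ⟨n, hn⟩ => ⟨n, ⟨n, Finset.mem_Iic.2 le_rfl⟩, hn⟩, fun ⟨_, i, hi⟩ => ⟨i, hi⟩⟩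
  have hmono : Monotone fun n : ℕ =>
      frestrictLe (π := fun _ => S) n ⁻¹' {x | ∃ i, x i ∈ T} := by
    rintro m n hmn ω ⟨i, hi⟩
    exact ⟨⟨i, Finset.mem_Iic.2 ((Finset.mem_Iic.1 i.2).trans hmn)⟩, hi⟩
  refine Measurable.ennreal_toReal ?_
  simp_rw [hset, hmono.measure_iUnion]
  refine Measurable.iSup fun n => ?_
  simp_rw [← Measure.map_apply (measurable_frestrictLe (X := fun _ => S) n)
    (Set.toFinite {x : (i : Finset.Iic n) → S | ∃ i, x i ∈ T}).measurableSet]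
  have hsum (u : D.paramSpace) :
      (D.instantiate u).pathMeasure.map (frestrictLe (π := fun _ => S) n) {x | ∃ i, x i ∈ T} =
        ∑ x with ∃ i, x i ∈ T,
          (D.instantiate u).pathMeasure.map (frestrictLe (π := fun _ => S) n) {x} := by
    rw [sum_measure_singleton]
    simp
  simp_rw [hsum]
  exact Finset.measurable_sum _ fun x _ =>
    D.measurable_map_frestrictLe_pathMeasure_singleton n x

theorem UncertainMC.measurableSet_satSet {S V : Type*} [Fintype S]
    [MeasurableSpace S] [DiscreteMeasurableSpace S] [Finite V] (D : UncertainMC S V)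
    (φ : ReachSpec S) : MeasurableSet (D.satSet φ) :=
  measurableSet_le (D.pmc.measurable_reachProb_instantiate φ.target) measurable_const

theorem UncertainMC.satProb_eq_measureReal {S V : Type*} [Fintype S]
    [MeasurableSpace S] [DiscreteMeasurableSpace S] [Finite V] (D : UncertainMC S V)
    (φ : ReachSpec S) : D.satProb φ = D.dist.real (D.satSet φ) :=
  integral_indicator_one (D.measurableSet_satSet φ)

theorem ProbabilityTheory.iIndepFun.measureReal_forall_mem_of_hasLaw {Ω α ι : Type*} [Fintype ι]
    [MeasurableSpace Ω] [MeasurableSpace α] {μ : Measure Ω} {P : Measure α} {U : ι → Ω → α}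
    (hU_law : ∀ k, HasLaw (U k) P μ) (hU : iIndepFun U μ) {A : Set α} (hA : MeasurableSet A) :
    μ.real {ω | ∀ k, U k ω ∈ A} = P.real A ^ Fintype.card ι := by
  have h := hU.measure_inter_preimage_eq_mul Finset.univ (sets := fun _ => A) fun _ _ => hA
  have hk (k : ι) : μ (U k ⁻¹' A) = P A := (hU_law k).measure_eq hA
  have hset : {ω | ∀ k, U k ω ∈ A} = ⋂ k ∈ Finset.univ, U k ⁻¹' A := by
    ext ω
    simp
  rw [measureReal_def, hset, h]
  simp [hk, measureReal_def]

theorem one_sub_pow_le_confidenceProb (K : ℕ) {ν : ℝ} (hν : ν ∈ Set.Icc (0 : ℝ) 1) :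
    (1 - ν) ^ K ≤ confidenceProb K ν := by
  have h0 : 0 ≤ ν := hν.1
  have h1 : 0 ≤ 1 - ν := sub_nonneg.2 hν.2
  have : 0 ≤ (K : ℝ) * (1 - ν) ^ (K - 1) * ν := by positivity
  simpa [confidenceProb, Finset.sum_range_succ] using this

theorem mainTheorem5 {S V : Type*} [Fintype S] [MeasurableSpace S] [DiscreteMeasurableSpace S]
    [Finite V] (D : UncertainMC S V) (φ : ReachSpec S)
    {Ω : Type*} [MeasurableSpace Ω] (μ : Measure Ω) [IsProbabilityMeasure μ]
    (K : ℕ) (hK : 2 ≤ K) (U : Fin K → Ω → D.pmc.paramSpace)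
    (hU_law : ∀ k, HasLaw (U k) D.dist μ) (hU_indep : iIndepFun U μ)
    (ν : ℝ) (hν : ν ∈ Set.Ico (0 : ℝ) 1) :
    MeasurableSet (D.satSet φ) ∧
      1 - confidenceProb K ν ≤
        μ.real {ω | (∀ k, (D.pmc.instantiate (U k ω)).Satisfies φ) → 1 - ν ≤ D.satProb φ} := by
  have hA := D.measurableSet_satSet φ
  refine ⟨hA, ?_⟩
  have hα := one_sub_pow_le_confidenceProb K (Set.Ico_subset_Icc_self hν)
  have hν1 : 0 ≤ 1 - ν := sub_nonneg.2 hν.2.le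
  by_cases hF : 1 - ν ≤ D.satProb φ
  · have : 0 ≤ (1 - ν) ^ K := by positivity
    simp only [hF, implies_true, Set.ofPred_true, probReal_univ]
    linarith
  · have hset : {ω | (∀ k, (D.pmc.instantiate (U k ω)).Satisfies φ) → 1 - ν ≤ D.satProb φ} =
        {ω | ∀ k, U k ω ∈ D.satSet φ}ᶜ := by
      ext ω
      simp only [hF, imp_false]
      rfl
    -- the `U k` are only almost everywhere measurable
    have hnull : NullMeasurableSet {ω | ∀ k, U k ω ∈ D.satSet φ} μ := by
      rw [Set.ofPred_forall]
      exact .iInter fun k => (hU_law k).aemeasurable.nullMeasurableSet_preimage hA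
    rw [hset, probReal_compl_eq_one_sub₀ hnull,
      hU_indep.measureReal_forall_mem_of_hasLaw hU_law hA, Fintype.card_fin,
      ← D.satProb_eq_measureReal φ]
    have hF0 : 0 ≤ D.satProb φ := by
      rw [D.satProb_eq_measureReal φ]
      exact measureReal_nonneg
    have := pow_le_pow_left₀ hF0 (not_le.1 hF).le K
    linarith
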